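/- For a rational number $x$ and an integer $k\ge 0$ let $(x)_k=x(x+1)\cdots(x+k-1)$, with $(x)_0=1$. For rationals $A,B$ and a prime $p$, write $A\equiv B\pmod{p^6}$ if $A-B=p^6c$ for some rational $c$ whose denominator is prime to $p$. Let $p$ be an odd prime and let $d,m,r$ be positive integers with $r\le p$, $p\equiv r\pmod d$, $\gcd(r,d)=1$ and $d\ge m\ge 2$. Then $$ \begin{aligned} &\sum_{\substack{i_1,\dots,i_m\ge 0\\ i_1+\cdots+i_m\le p-1}}\ \prod_{l=1}^{m}(2di_l+r)\frac{(\frac rd)_{i_l}^6}{(1)_{i_l}^6}\\ &\quad\equiv p^m\,\frac{(\frac{2r}{d})_{(p-r)/d}^m}{(1)_{(p-r)/d}^m} \left\{\sum_{k=0}^{(p-r)/d}\frac{(\frac rd)_k^3(\frac{d-r}{d})_k}{(1)_k^3(\frac{2r}{d})_k}\right\}^{m-1}\\ &\qquad\times\sum_{k=0}^{(p-r)/d}\frac{(\frac rd)_k^3(\frac{d-r}{d})_k}{(1)_k^3(\frac{2r}{d})_k} \left\{1-mp^2\sum_{t=1}^{k}\left(\frac{1}{(dt-d+r)^2}+\frac{1}{(dt)^2}\right)\right\}\pmod{p^6}.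 \end{aligned} $$ -/

import Mathlib

/-- The shifted factorial `(x)_k = Γ(x + k) / Γ(x) = x (x + 1) ⋯ (x + k - 1)` of a rational `x`. -/
noncomputable def shiftedFactorial (x : ℚ) (k : ℕ) : ℚ :=
  (ascPochhammer ℚ k).eval x

/-- Congruence of rational numbers modulo a positive integer `N`: the difference `a - b` is `N`
times a rational number whose reduced denominator is coprime to `N`. For `N` a power of a prime
`p` this is congruence modulo `N` over the ring of `p`-integral rationals. -/
def RatModEq (N : ℕ) (a b : ℚ) : Prop :=
  ∃ c : ℚ, c.den.Coprime N ∧ a - b = (N : ℚ) * c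

/-- The set of all `m`-tuples `(i_1, …, i_m)` of nonnegative integers with
`i_1 + ⋯ + i_m ≤ N`. -/
def boundedTuples (m N : ℕ) : Finset (Fin m → ℕ) :=
  (Fintype.piFinset fun _ : Fin m => Finset.range (N + 1)).filter fun i => ∑ l, i l ≤ N

theorem mem_boundedTuples {m N : ℕ} {i : Fin m → ℕ} :
    i ∈ boundedTuples m N ↔ ∑ l, i l ≤ N := by
  unfold boundedTuples
  simp only [Finset.mem_filter, Fintype.mem_piFinset, Finset.mem_range, and_iff_right_iff_imp]
  intro h l
  exact Nat.lt_succ_of_le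
    ((Finset.single_le_sum (fun j _ => Nat.zero_le (i j)) (Finset.mem_univ l)).trans h)

/-- The `k`-th term `(r/d)_k^3 ((d-r)/d)_k / ((1)_k^3 (2r/d)_k)` of the truncated
hypergeometric series. -/
noncomputable def hypTerm (d r k : ℕ) : ℚ :=
  shiftedFactorial ((r : ℚ) / d) k ^ 3 * shiftedFactorial (((d : ℚ) - r) / d) k /
    (shiftedFactorial 1 k ^ 3 * shiftedFactorial (2 * (r : ℚ) / d) k)

/-! Put n = (p - r)/d, so p = r + nd. For k > n the factor r/d + n = p/d occurs in (r/d)_k, so a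
single term with n < k < p vanishes modulo p^6. Since mn ≤ nd < p, the remaining tuples fill the
whole cube [0, n]^m, and the multiple sum is congruent to S^m, where S is the single sum up to n
(`sum_boundedTuples_pCong`).

S is evaluated modulo p^5 by deforming its parameters. With a = r/d and x = p/d, replace four of the
six copies of a by a ± x, a ± ix. The deformed very-well-poised terms depend on x only through x^4,
and the resulting p^4 correction is antisymmetric under k ↦ n - k modulo p, so it disappears modulo
p^5 (`sum_vwp_pCong`). As a - x = -n, the deformed series terminates, and `whipple` turns it into x
times a factor C times a balanced ₄F₃ series. Expanding that series to order p^2 gives S ≡ p C (F +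
p^2 H) modulo p^5 (`sum_sixthTerm_pCong`). Dividing by p, taking the m-th power to first order in
p^2 and restoring p^m gives precision p^(m+4), which suffices because m ≥ 2.

`whipple` itself follows from two terminating summations, `saalschutz` and `sum_wellPoisedTerm`,
after an exchange of sums. -/

open Finset

/-! ### Shifted factorials -/

theorem shiftedFactorial_zero (x : ℚ) : shiftedFactorial x 0 = 1 := by
  simp [shiftedFactorial]

theorem shiftedFactorial_succ (x : ℚ) (k : ℕ) :
    shiftedFactorial x (k + 1) = shiftedFactorial x k * (x + k) := by
  simp [shiftedFactorial, ascPochhammer_succ_eval]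

theorem shiftedFactorial_add (x : ℚ) (j i : ℕ) :
    shiftedFactorial x (j + i) = shiftedFactorial x j * shiftedFactorial (x + j) i := by
  induction i with
  | zero => simp [shiftedFactorial_zero]
  | succ i ih =>
    rw [← add_assoc, shiftedFactorial_succ, shiftedFactorial_succ, ih]
    push_cast
    ring

theorem shiftedFactorial_succ_left (x : ℚ) (k : ℕ) :
    shiftedFactorial x (k + 1) = x * shiftedFactorial (x + 1) k := by
  rw [add_comm k 1, shiftedFactorial_add, shiftedFactorial_succ, shiftedFactorial_zero]
  simp

theorem shiftedFactorial_one (k : ℕ) : shiftedFactorial 1 k = (k.factorial : ℚ) := by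
  induction k with
  | zero => simp [shiftedFactorial_zero]
  | succ k ih =>
    rw [shiftedFactorial_succ, ih, Nat.factorial_succ]
    push_cast
    ring

theorem shiftedFactorial_eq_prod (x : ℚ) (k : ℕ) :
    shiftedFactorial x k = ∏ j ∈ range k, (x + j) := by
  induction k with
  | zero => simp [shiftedFactorial_zero]
  | succ k ih => rw [shiftedFactorial_succ, prod_range_succ, ih]

theorem shiftedFactorial_ne_zero {x : ℚ} {k : ℕ} (h : ∀ j < k, x + j ≠ 0) :
    shiftedFactorial x k ≠ 0 := by
  rw [shiftedFactorial_eq_prod, prod_ne_zero_iff]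
  exact fun j hj => h j (mem_range.1 hj)

theorem shiftedFactorial_pos {x : ℚ} (hx : 0 < x) (k : ℕ) : 0 < shiftedFactorial x k := by
  rw [shiftedFactorial_eq_prod]
  exact prod_pos fun j _ => by positivity

theorem shiftedFactorial_neg_eq_zero {n k : ℕ} (h : n < k) :
    shiftedFactorial (-(n : ℚ)) k = 0 := by
  rw [shiftedFactorial_eq_prod]
  exact prod_eq_zero (mem_range.2 h) (by simp)

/-- Reversing the order of the factors of a shifted factorial. -/
theorem shiftedFactorial_reverse (x : ℚ) (n : ℕ) :
    shiftedFactorial (1 - x - n) n = (-1) ^ n * shiftedFactorial x n := by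
  induction n with
  | zero => simp [shiftedFactorial_zero]
  | succ n ih =>
    rw [shiftedFactorial_succ_left, shiftedFactorial_succ x, pow_succ]
    have : (1 - x - ((n + 1 : ℕ) : ℚ) + 1) = 1 - x - n := by push_cast; ring
    rw [this, ih]
    push_cast
    ring

/-! ### The balanced ₃F₂ summation -/

/-- The product `∏_{t ≤ j} (t ^ 2 - y)`. -/
def sqProd (y : ℚ) (j : ℕ) : ℚ := ∏ t ∈ range j, (((t : ℚ) + 1) ^ 2 - y)

theorem sqProd_succ (y : ℚ) (j : ℕ) :
    sqProd y (j + 1) = sqProd y j * (((j : ℚ) + 1) ^ 2 - y) := prod_range_succ _ _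

theorem sqProd_ne_zero {y : ℚ} (hy : ∀ t : ℕ, ((t : ℚ) + 1) ^ 2 - y ≠ 0) (j : ℕ) :
    sqProd y j ≠ 0 := prod_ne_zero_iff.2 fun t _ => hy t

/-- The coefficients of the balanced series in `saalschutz`. -/
noncomputable def saalCoeff (a : ℚ) (k j : ℕ) : ℚ :=
  shiftedFactorial (-(k : ℚ)) j * shiftedFactorial (a + k) j * shiftedFactorial (1 - a) j /
    shiftedFactorial 1 j

/-- A creative-telescoping certificate: the first-order recurrence in k satisfied by the full sum,
with its boundary term at an arbitrary cutoff so that induction on the cutoff proves it. -/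
theorem saalCoeff_partial_sum {a y : ℚ} (hy : ∀ t : ℕ, ((t : ℚ) + 1) ^ 2 - y ≠ 0) (k M : ℕ) :
    (((k : ℚ) + 1) ^ 2 - y) * ∑ j ∈ range (M + 1), saalCoeff a (k + 1) j / sqProd y j -
      ((a + k) ^ 2 - y) * ∑ j ∈ range (M + 1), saalCoeff a k j / sqProd y j =
    shiftedFactorial (-(k : ℚ)) M * shiftedFactorial (a + k + 1) M *
      shiftedFactorial (1 - a) (M + 1) * (a + 2 * k + 1) / (shiftedFactorial 1 M * sqProd y M) := by
  induction M with
  | zero =>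
    simp [saalCoeff, shiftedFactorial_zero, shiftedFactorial_succ, sqProd]
    ring
  | succ M ih =>
    rw [sum_range_succ, mul_add, sum_range_succ _ (M + 1), mul_add, add_sub_add_comm, ih]
    have h1 : shiftedFactorial 1 M ≠ 0 := (shiftedFactorial_pos one_pos M).ne'
    have h2 := sqProd_ne_zero hy M
    have h3 := hy M
    have h4 : (M : ℚ) + 1 ≠ 0 := by positivity
    have e1 : shiftedFactorial (-((k + 1 : ℕ) : ℚ)) (M + 1) =
        -(k + 1) * shiftedFactorial (-(k : ℚ)) M := by
      rw [shiftedFactorial_succ_left]; push_cast; ring_nf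
    have e2 : shiftedFactorial (a + k) (M + 1) = (a + k) * shiftedFactorial (a + k + 1) M :=
      shiftedFactorial_succ_left _ _
    have e3 : shiftedFactorial (a + ((k + 1 : ℕ) : ℚ)) (M + 1) =
        shiftedFactorial (a + k + 1) M * (a + k + 1 + M) := by
      rw [shiftedFactorial_succ]; push_cast; ring_nf
    simp only [saalCoeff, e1, e2, e3, shiftedFactorial_succ, sqProd_succ]
    rw [add_comm (1 : ℚ) (M : ℚ)]
    field_simp
    push_cast
    ring

/-- The lower parameters are 1 ± √y, but only their symmetric products enter. Everything therefore
stays rational, and y may be negative, which is how imaginary parameters are reached later. -/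
theorem saalschutz {a y : ℚ} (hy : ∀ t : ℕ, ((t : ℚ) + 1) ^ 2 - y ≠ 0) (k : ℕ) :
    ∑ j ∈ range (k + 1), saalCoeff a k j / sqProd y j =
      (∏ t ∈ range k, ((a + t) ^ 2 - y)) / sqProd y k := by
  induction k with
  | zero => simp [saalCoeff, shiftedFactorial_zero, sqProd]
  | succ k ih =>
    -- At cutoff k + 1 both sums are complete, and the boundary term contains (-k)_{k+1} = 0.
    have h := saalCoeff_partial_sum (a := a) hy k (k + 1)
    rw [shiftedFactorial_neg_eq_zero (Nat.lt_succ_self k), sum_range_succ (fun j =>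
      saalCoeff a k j / sqProd y j) (k + 1), ih] at h
    have h0 : saalCoeff a k (k + 1) = 0 := by
      simp [saalCoeff, shiftedFactorial_neg_eq_zero (Nat.lt_succ_self k)]
    have h2 := sqProd_ne_zero hy k
    have h3 := hy k
    rw [h0] at h
    rw [prod_range_succ, sqProd_succ, eq_div_iff (mul_ne_zero h2 h3)]
    field_simp at h
    linear_combination h

/-! ### The very-well-poised ₅F₄ summation -/

/-- The terms of the terminating very-well-poised `₅F₄` series. -/
noncomputable def wellPoisedTerm (α b c : ℚ) (N k : ℕ) : ℚ :=
  (α + 2 * k) * (shiftedFactorial α k * shiftedFactorial b k * shiftedFactorial c k *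
    shiftedFactorial (-(N : ℚ)) k) /
    (shiftedFactorial 1 k * shiftedFactorial (1 + α - b) k * shiftedFactorial (1 + α - c) k *
      shiftedFactorial (1 + α + N) k)

/-- Again a telescoping certificate, now for the recurrence in N; the boundary term carries (-N)_M
and dies at M = N + 1. -/
theorem wellPoisedTerm_partial_sum {α b c : ℚ} {N : ℕ} (hα : 0 < α)
    (hb : ∀ k < N + 1, 1 + α - b + k ≠ 0) (hc : ∀ k < N + 1, 1 + α - c + k ≠ 0)
    (M : ℕ) (hM : M ≤ N + 1) :
    (1 + α - b + N) * (1 + α - c + N) * ∑ k ∈ range (M + 1), wellPoisedTerm α b c (N + 1) k -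
      (1 + α + N) * (1 + α - b - c + N) * ∑ k ∈ range (M + 1), wellPoisedTerm α b c N k =
    shiftedFactorial α (M + 1) * shiftedFactorial b (M + 1) * shiftedFactorial c (M + 1) *
      shiftedFactorial (-(N : ℚ)) M /
    (shiftedFactorial 1 M * shiftedFactorial (1 + α - b) M * shiftedFactorial (1 + α - c) M *
      shiftedFactorial (2 + α + N) M) := by
  induction M with
  | zero =>
    simp [wellPoisedTerm, shiftedFactorial_zero, shiftedFactorial_succ]
    ring
  | succ M ih =>
    have split : ∀ A B s t s' t' : ℚ, A * (s + t) - B * (s' + t') =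
      A * s - B * s' + (A * t - B * t') := by intros; ring
    rw [sum_range_succ, sum_range_succ _ (M + 1), split, ih (by omega)]
    have h1 : shiftedFactorial 1 M ≠ 0 := (shiftedFactorial_pos one_pos M).ne'
    have h4 : (M : ℚ) + 1 ≠ 0 := by positivity
    have hb' : shiftedFactorial (1 + α - b) M ≠ 0 :=
      shiftedFactorial_ne_zero fun k hk => hb k (by omega)
    have hc' : shiftedFactorial (1 + α - c) M ≠ 0 :=
      shiftedFactorial_ne_zero fun k hk => hc k (by omega)
    have hbM := hb M (by omega)
    have hcM := hc M (by omega)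
    have h5 : shiftedFactorial (2 + α + N) M ≠ 0 := (shiftedFactorial_pos (by positivity) M).ne'
    have h6 : 1 + α + N ≠ 0 := by positivity
    have h7 : 2 + α + N + M ≠ 0 := by positivity
    have e1 : shiftedFactorial (-((N + 1 : ℕ) : ℚ)) (M + 1) =
        -(N + 1) * shiftedFactorial (-(N : ℚ)) M := by
      rw [shiftedFactorial_succ_left]; push_cast; ring_nf
    have e2 : shiftedFactorial (1 + α + N) (M + 1) =
        (1 + α + N) * shiftedFactorial (2 + α + N) M := by
      rw [shiftedFactorial_succ_left]; ring_nf
    have e3 : shiftedFactorial (1 + α + ((N + 1 : ℕ) : ℚ)) (M + 1) =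
        shiftedFactorial (2 + α + N) M * (2 + α + N + M) := by
      rw [shiftedFactorial_succ]; push_cast; ring_nf
    simp only [wellPoisedTerm, e1, e2, e3, shiftedFactorial_succ]
    rw [add_comm (1 : ℚ) (M : ℚ)]
    generalize shiftedFactorial 1 M = f1 at *
    generalize shiftedFactorial (1 + α - b) M = f2 at *
    generalize shiftedFactorial (1 + α - c) M = f3 at *
    generalize shiftedFactorial (2 + α + N) M = f4 at *
    generalize shiftedFactorial (-(N : ℚ)) M = f5 at *
    generalize shiftedFactorial α M = f6 at *
    generalize shiftedFactorial b M = f7 at *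
    generalize shiftedFactorial c M = f8 at *
    field_simp
    push_cast
    ring

/-- The terminating very-well-poised `₅F₄` summation. -/
theorem sum_wellPoisedTerm {α b c : ℚ} (hα : 0 < α) (N : ℕ)
    (hb : ∀ k < N, 1 + α - b + k ≠ 0) (hc : ∀ k < N, 1 + α - c + k ≠ 0) :
    ∑ k ∈ range (N + 1), wellPoisedTerm α b c N k =
      shiftedFactorial α (N + 1) * shiftedFactorial (1 + α - b - c) N /
        (shiftedFactorial (1 + α - b) N * shiftedFactorial (1 + α - c) N) := by
  induction N with
  | zero => simp [wellPoisedTerm, shiftedFactorial_zero, shiftedFactorial_succ]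
  | succ N ih =>
    have h := wellPoisedTerm_partial_sum hα hb hc (N + 1) le_rfl
    rw [shiftedFactorial_neg_eq_zero (Nat.lt_succ_self N), sum_range_succ (fun j =>
      wellPoisedTerm α b c N j) (N + 1), ih (fun k hk => hb k (by omega))
        (fun k hk => hc k (by omega))] at h
    have h0 : wellPoisedTerm α b c N (N + 1) = 0 := by
      simp [wellPoisedTerm, shiftedFactorial_neg_eq_zero (Nat.lt_succ_self N)]
    have hb' : shiftedFactorial (1 + α - b) N ≠ 0 :=
      shiftedFactorial_ne_zero fun k hk => hb k (by omega)
    have hc' : shiftedFactorial (1 + α - c) N ≠ 0 :=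
      shiftedFactorial_ne_zero fun k hk => hc k (by omega)
    have hbN := hb N (by omega)
    have hcN := hc N (by omega)
    rw [h0] at h
    rw [shiftedFactorial_succ (1 + α - b), shiftedFactorial_succ (1 + α - c),
      shiftedFactorial_succ (1 + α - b - c), shiftedFactorial_succ α (N + 1),
      eq_div_iff (by positivity)]
    field_simp at h
    push_cast
    linear_combination h

/-! ### Whipple's transformation -/

/-- The terms of the very-well-poised `₇F₆` series with base `a` and numerator parameters
`a`, `a + x`, `a - x`, up to the two parameters `a ± √y`. -/
noncomputable def vwpTerm (a x : ℚ) (k : ℕ) : ℚ :=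
  (a + 2 * k) * (shiftedFactorial a k ^ 2 * shiftedFactorial (a + x) k *
    shiftedFactorial (a - x) k) /
    (shiftedFactorial 1 k ^ 2 * shiftedFactorial (1 - x) k * shiftedFactorial (1 + x) k)

theorem shiftedFactorial_neg_add (i j : ℕ) :
    shiftedFactorial (-((j + i : ℕ) : ℚ)) j * shiftedFactorial 1 i =
      (-1) ^ j * shiftedFactorial 1 (j + i) := by
  have h := shiftedFactorial_reverse (1 + i : ℚ) j
  have e : (1 - (1 + (i : ℚ)) - j) = -((j + i : ℕ) : ℚ) := by push_cast; ring
  rw [e] at h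
  rw [h, add_comm j i, shiftedFactorial_add 1 i j]
  ring

set_option maxHeartbeats 1000000 in
-- Weighting by the k-dependent part of the Saalschütz coefficient and shifting k = j + i raises the
-- base from a to a + 2j and leaves a ₅F₄ term, up to a factor independent of i.
theorem vwpTerm_add {a x : ℚ} {n : ℕ} (ha : 0 < a) (hx : x = a + n) (j N i : ℕ)
    (hn : j + N = n) (hi : i ≤ N) :
    vwpTerm a x (j + i) * (shiftedFactorial (-((j + i : ℕ) : ℚ)) j *
        shiftedFactorial (a + (j + i : ℕ)) j) =
      (-1) ^ j * (shiftedFactorial a (j + j) * shiftedFactorial a j * shiftedFactorial (a + x) j *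
        shiftedFactorial (a - x) j) / (shiftedFactorial 1 j * shiftedFactorial (1 - x) j *
          shiftedFactorial (1 + x) j) *
        wellPoisedTerm (a + (j + j : ℕ)) (a + x + j) (a + j) N i := by
  have hx0 : 0 < x := by rw [hx]; positivity
  have h1 : ∀ k, shiftedFactorial 1 k ≠ 0 := fun k => (shiftedFactorial_pos one_pos k).ne'
  have h2 : shiftedFactorial (1 + x) (j + i) ≠ 0 := (shiftedFactorial_pos (by positivity) _).ne'
  have h3 : shiftedFactorial (1 - x) (j + i) ≠ 0 := by
    -- Here 1 - x + k = (k + 1 - n) - a is negative for every k < n.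
    refine shiftedFactorial_ne_zero fun k hk => ?_
    have : (k : ℚ) + 1 ≤ n := by exact_mod_cast (by omega : k + 1 ≤ n)
    rw [hx]
    intro h
    linarith
  have e0 := shiftedFactorial_neg_add i j
  -- One of the two copies of (a)_k absorbs (a + k)_j; this is what produces the base a + 2j.
  have e1 : shiftedFactorial a (j + i) * shiftedFactorial (a + (j + i : ℕ)) j =
      shiftedFactorial a (j + j) * shiftedFactorial (a + (j + j : ℕ)) i := by
    rw [← shiftedFactorial_add, ← shiftedFactorial_add]
    congr 1
    omega
  have e2 := shiftedFactorial_add a j i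
  have e3 := shiftedFactorial_add (a + x) j i
  have e4 : shiftedFactorial (a - x) (j + i) =
      shiftedFactorial (a - x) j * shiftedFactorial (-(N : ℚ)) i := by
    rw [shiftedFactorial_add, hx, ← hn]; push_cast; ring_nf
  have e5 := shiftedFactorial_add 1 j i
  have e6 := shiftedFactorial_add (1 - x) j i
  have e7 := shiftedFactorial_add (1 + x) j i
  have d1 : 1 + (a + (j + j : ℕ)) - (a + x + j) = 1 - x + j := by push_cast; ring
  have d2 : 1 + (a + (j + j : ℕ)) - (a + j) = (1 : ℚ) + j := by push_cast; ring
  have d3 : 1 + (a + (j + j : ℕ)) + N = 1 + x + j := by rw [hx, ← hn]; push_cast; ring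
  have d4 : a + ((j + j : ℕ) : ℚ) + 2 * i = a + 2 * (j + i : ℕ) := by push_cast; ring
  unfold wellPoisedTerm vwpTerm
  rw [d1, d2, d3, d4]
  have h1' := h1 (j + i)
  have hi' := h1 i
  have hj' := h1 j
  rw [e6] at h3
  rw [e7] at h2
  rw [e5] at h1'
  have h1i := right_ne_zero_of_mul h1'
  have h2j := left_ne_zero_of_mul h2
  have h2i := right_ne_zero_of_mul h2
  have h3j := left_ne_zero_of_mul h3
  have h3i := right_ne_zero_of_mul h3
  have e0' : shiftedFactorial (-((j + i : ℕ) : ℚ)) j =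
      (-1) ^ j * shiftedFactorial 1 (j + i) / shiftedFactorial 1 i := by
    rw [← e0]; field_simp
  rw [e0', sq (shiftedFactorial a (j + i))]
  have : ∀ u v w z f g : ℚ, u * (v * v * w * z) / f * (g * shiftedFactorial (a + (j + i : ℕ)) j) =
      u * (v * w * z) / f * g * (v * shiftedFactorial (a + (j + i : ℕ)) j) := by intros; ring
  rw [this, e1, e2, e3, e4, e5, e6, e7]
  clear e0' this e0 e1 e2 e3 e4 e5 e6 e7 d1 d2 d3 d4 h1' h2 h3 h1
  generalize shiftedFactorial (-((j + i : ℕ) : ℚ)) j = g0 at *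
  generalize shiftedFactorial (1 + x) j = g1 at *
  generalize shiftedFactorial (1 + x + j) i = g2 at *
  generalize shiftedFactorial (1 - x) j = g3 at *
  generalize shiftedFactorial (1 - x + j) i = g4 at *
  generalize shiftedFactorial 1 j = g5 at *
  generalize shiftedFactorial 1 i = g6 at *
  generalize shiftedFactorial (1 + (j : ℚ)) i = g7 at *
  field_simp

theorem sum_vwpTerm {a x : ℚ} {n : ℕ} (ha : 0 < a) (hx : x = a + n) (j N : ℕ) (hn : j + N = n) :
    ∑ i ∈ range (N + 1), vwpTerm a x (j + i) * (shiftedFactorial (-((j + i : ℕ) : ℚ)) j *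
        shiftedFactorial (a + (j + i : ℕ)) j) =
      x * (shiftedFactorial (2 * a) n / shiftedFactorial 1 n) *
        (shiftedFactorial a j * shiftedFactorial (a + x) j * shiftedFactorial (a - x) j /
          shiftedFactorial (2 * a) j) := by
  have hx0 : 0 < x := by rw [hx]; positivity
  have hne : ∀ k < n, 1 - x + k ≠ 0 := by
    intro k hk h
    have : (k : ℚ) + 1 ≤ n := by exact_mod_cast hk
    rw [hx] at h
    linarith
  have d1 : 1 + (a + (j + j : ℕ)) - (a + x + j) = 1 - x + j := by push_cast; ring
  have d2 : 1 + (a + (j + j : ℕ)) - (a + j) = (1 : ℚ) + j := by push_cast; ring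
  -- This puts the last factor of the ₅F₄ sum in reversible form, so it becomes ± (2a + j)_N.
  have d3 : 1 - x + j - (a + j) = 1 - (2 * a + j) - N := by rw [hx, ← hn]; push_cast; ring
  rw [sum_congr rfl fun i hi => vwpTerm_add ha hx j N i hn (by grind), ← mul_sum,
    sum_wellPoisedTerm (by positivity) N, d1, d2, d3, shiftedFactorial_reverse]
  · have e1 : shiftedFactorial (a + (j + j : ℕ)) (N + 1) * shiftedFactorial a (j + j) =
        shiftedFactorial a n * x * shiftedFactorial (1 + x) j := by
      rw [mul_comm, ← shiftedFactorial_add, show j + j + (N + 1) = n + (1 + j) by omega,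
        shiftedFactorial_add a n, add_comm 1 j, shiftedFactorial_succ_left, hx]
      ring_nf
    have e2 : shiftedFactorial (1 - x) j * shiftedFactorial (1 - x + j) N =
        (-1) ^ n * shiftedFactorial a n := by
      rw [← shiftedFactorial_add, hn, ← shiftedFactorial_reverse, hx]
      ring_nf
    have e3 : shiftedFactorial (2 * a) j * shiftedFactorial (2 * a + j) N =
        shiftedFactorial (2 * a) n := by rw [← shiftedFactorial_add, hn]
    have e4 : shiftedFactorial 1 j * shiftedFactorial (1 + j) N = shiftedFactorial 1 n := by
      rw [← shiftedFactorial_add, hn]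
    have e5 : (-1 : ℚ) ^ n = (-1) ^ j * (-1) ^ N := by rw [← pow_add, hn]
    have p1 := (shiftedFactorial_pos ha n).ne'
    have p2 := (shiftedFactorial_pos one_pos n).ne'
    have p3 := (shiftedFactorial_pos (by positivity : 0 < 2 * a) j).ne'
    have p4 := (shiftedFactorial_pos (by positivity : 0 < 1 + x) j).ne'
    have p5 : ((-1 : ℚ)) ^ n ≠ 0 := by positivity
    have p6 : (-1 : ℚ) ^ n * (-1) ^ n = 1 := by rw [← mul_pow]; simp
    calc _ = ((-1) ^ j * (-1) ^ N) * (shiftedFactorial a j * shiftedFactorial (a + x) j *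
          shiftedFactorial (a - x) j) * shiftedFactorial (2 * a + j) N *
          (shiftedFactorial (a + (j + j : ℕ)) (N + 1) * shiftedFactorial a (j + j)) /
          ((shiftedFactorial 1 j * shiftedFactorial (1 + j) N) *
            (shiftedFactorial (1 - x) j * shiftedFactorial (1 - x + j) N) *
            shiftedFactorial (1 + x) j) := by
            rw [div_mul_div_comm]
            congr 1 <;> ring
      _ = _ := by
        rw [e1, e2, e4, ← e5, ← e3]
        clear e1 e2 e3 e4 e5 d1 d2 d3 hne
        generalize shiftedFactorial (2 * a) j = g1 at *
        generalize shiftedFactorial (2 * a + j) N = g2 at *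
        field_simp
  · intro k hk
    rw [d1]
    have := hne (j + k) (by omega)
    push_cast at this
    rwa [← add_assoc] at this
  · intro k _
    rw [d2]
    positivity

/-- Whipple's transformation of a very-well-poised `₇F₆` series into a balanced `₄F₃` series,
for the parameters `a + √y`, `a - √y`, `a + x`, `a`, `a - x = -n`. -/
theorem whipple {a x y : ℚ} {n : ℕ} (ha : 0 < a) (hx : x = a + n)
    (hy : ∀ t : ℕ, ((t : ℚ) + 1) ^ 2 - y ≠ 0) :
    ∑ k ∈ range (n + 1), vwpTerm a x k *
        ((∏ t ∈ range k, ((a + t) ^ 2 - y)) / sqProd y k) =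
      x * (shiftedFactorial (2 * a) n / shiftedFactorial 1 n) *
        ∑ j ∈ range (n + 1), shiftedFactorial a j * shiftedFactorial (1 - a) j *
          shiftedFactorial (a + x) j * shiftedFactorial (a - x) j /
            (shiftedFactorial 1 j * shiftedFactorial (2 * a) j * sqProd y j) := by
  have hL : ∀ k ∈ range (n + 1), vwpTerm a x k *
        ((∏ t ∈ range k, ((a + t) ^ 2 - y)) / sqProd y k) =
      ∑ j ∈ range (k + 1), vwpTerm a x k * (saalCoeff a k j / sqProd y j) := by
    intro k _
    rw [← saalschutz hy, mul_sum]
  rw [sum_congr rfl hL, mul_sum]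
  -- After the Saalschütz expansion y sits only in the factor indexed by j, so for fixed j the sum
  -- over k ≥ j is free of y.
  rw [sum_comm' (t' := range (n + 1)) (s' := fun j => Ico j (n + 1)) (by grind)]
  refine sum_congr rfl fun j hj => ?_
  obtain ⟨N, hN⟩ := Nat.exists_eq_add_of_le (Nat.lt_succ_iff.1 (mem_range.1 hj))
  have h := sum_vwpTerm ha hx j N hN.symm
  rw [sum_Ico_eq_sum_range, show n + 1 - j = N + 1 by omega]
  have hk : ∀ k, vwpTerm a x k * (saalCoeff a k j / sqProd y j) =
      vwpTerm a x k * (shiftedFactorial (-(k : ℚ)) j * shiftedFactorial (a + k) j) *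
        (shiftedFactorial (1 - a) j / (shiftedFactorial 1 j * sqProd y j)) := by
    intro k
    rw [saalCoeff]
    ring
  rw [sum_congr rfl fun i _ => hk (j + i), ← sum_mul, h, mul_assoc, div_mul_div_comm]
  congr 2 <;> ring

/-! ### Arithmetic of p-integral rationals -/

/-- The ring of `p`-integral rationals. -/
def pIntegers (p : ℕ) : Subring ℚ where
  carrier := {q | q.den.Coprime p}
  mul_mem' {a b} ha hb := Nat.Coprime.of_dvd_left (Rat.mul_den_dvd a b) (Nat.Coprime.mul_left ha hb)
  one_mem' := by simp
  add_mem' {a b} ha hb := Nat.Coprime.of_dvd_left (Rat.add_den_dvd a b) (Nat.Coprime.mul_left ha hb)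
  zero_mem' := by simp
  neg_mem' {a} ha := by simpa using ha

theorem mem_pIntegers {p : ℕ} {q : ℚ} : q ∈ pIntegers p ↔ q.den.Coprime p := Iff.rfl

theorem exists_eq_mul_of_inv_notMem {p : ℕ} (hp : p.Prime) {q : ℚ} (hq : q ∈ pIntegers p)
    (h : q⁻¹ ∉ pIntegers p) : ∃ c ∈ pIntegers p, q = p * c := by
  have hdvd : (p : ℤ) ∣ q.num := by
    by_cases h0 : q = 0
    · simp [h0]
    · rw [mem_pIntegers, Rat.inv_def, Rat.divInt_eq_div] at h
      by_contra hn
      apply h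
      have hc : q.num.natAbs.Coprime p :=
        ((Nat.Prime.coprime_iff_not_dvd hp).2 fun h' => hn (Int.natCast_dvd.2 h')).symm
      refine Nat.Coprime.of_dvd_left ?_ hc
      have := Rat.den_dvd (q.den : ℤ) q.num
      rw [Rat.divInt_eq_div] at this
      exact Int.natCast_dvd.1 this
  obtain ⟨z, hz⟩ := hdvd
  refine ⟨z / q.den, ?_, ?_⟩
  · have := Rat.den_dvd z (q.den : ℤ)
    rw [Rat.divInt_eq_div] at this
    exact Nat.Coprime.of_dvd_left (by exact_mod_cast this) (mem_pIntegers.1 hq)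
  · rw [← mul_div_assoc]
    nth_rewrite 1 [← Rat.num_div_den q]
    rw [hz]
    push_cast
    rfl

theorem inv_natCast_mem {p m : ℕ} (hp : p.Prime) (h : ¬ p ∣ m) : (m : ℚ)⁻¹ ∈ pIntegers p := by
  rw [mem_pIntegers]
  rcases Nat.eq_zero_or_pos m with rfl | hm
  · simp
  · rw [Rat.inv_natCast_den_of_pos hm]
    exact ((Nat.Prime.coprime_iff_not_dvd hp).2 h).symm

/-- Otherwise 1 - p^k e would be p times a p-integral number, forcing 1/p to be p-integral. -/
theorem inv_one_sub_mem {p : ℕ} (hp : p.Prime) {k : ℕ} (hk : k ≠ 0) {e : ℚ}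
    (he : e ∈ pIntegers p) : (1 - (p : ℚ) ^ k * e)⁻¹ ∈ pIntegers p := by
  by_contra h
  obtain ⟨c, hc, h1⟩ := exists_eq_mul_of_inv_notMem hp
    (sub_mem (one_mem _) (mul_mem (pow_mem (natCast_mem _ p) k) he)) h
  obtain ⟨l, rfl⟩ := Nat.exists_eq_succ_of_ne_zero hk
  have hp0 : (p : ℚ) ≠ 0 := by exact_mod_cast hp.ne_zero
  have : (p : ℚ)⁻¹ = c + p ^ l * e := by
    rw [inv_eq_iff_eq_inv, eq_comm, inv_eq_iff_eq_inv, eq_comm, inv_eq_of_mul_eq_one_right]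
    rw [pow_succ] at h1
    linear_combination -h1
  have hm : (p : ℚ)⁻¹ ∈ pIntegers p :=
    this ▸ add_mem hc (mul_mem (pow_mem (natCast_mem _ p) l) he)
  rw [mem_pIntegers, Rat.inv_natCast_den_of_pos hp.pos, Nat.coprime_self] at hm
  exact hp.one_lt.ne' hm

/-- Congruence of rationals modulo `p ^ k` over the `p`-integral rationals. -/
def PCong (p k : ℕ) (a b : ℚ) : Prop := ∃ c ∈ pIntegers p, a - b = (p : ℚ) ^ k * c

namespace PCong

variable {p k : ℕ} {a b c e : ℚ}

theorem refl (a : ℚ) : PCong p k a a := ⟨0, zero_mem _, by simp⟩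

theorem symm (h : PCong p k a b) : PCong p k b a := by
  obtain ⟨u, hu, h⟩ := h
  exact ⟨-u, neg_mem hu, by linear_combination -h⟩

theorem trans (h : PCong p k a b) (h' : PCong p k b c) : PCong p k a c := by
  obtain ⟨u, hu, h⟩ := h
  obtain ⟨v, hv, h'⟩ := h'
  exact ⟨u + v, add_mem hu hv, by linear_combination h + h'⟩

theorem add (h : PCong p k a b) (h' : PCong p k c e) : PCong p k (a + c) (b + e) := by
  obtain ⟨u, hu, h⟩ := h
  obtain ⟨v, hv, h'⟩ := h'
  exact ⟨u + v, add_mem hu hv, by linear_combination h + h'⟩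

theorem neg (h : PCong p k a b) : PCong p k (-a) (-b) := by
  obtain ⟨u, hu, h⟩ := h
  exact ⟨-u, neg_mem hu, by linear_combination -h⟩

theorem sub (h : PCong p k a b) (h' : PCong p k c e) : PCong p k (a - c) (b - e) := by
  simpa only [sub_eq_add_neg] using h.add h'.neg

theorem mem (h : PCong p k a b) (hb : b ∈ pIntegers p) : a ∈ pIntegers p := by
  obtain ⟨u, hu, h⟩ := h
  rw [show a = b + p ^ k * u by linear_combination h]
  exact add_mem hb (mul_mem (pow_mem (natCast_mem _ p) k) hu)

theorem mul (h : PCong p k a b) (h' : PCong p k c e) (hb : b ∈ pIntegers p)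
    (he : e ∈ pIntegers p) : PCong p k (a * c) (b * e) := by
  have hc := h'.mem he
  obtain ⟨u, hu, h⟩ := h
  obtain ⟨v, hv, h'⟩ := h'
  exact ⟨u * c + b * v, add_mem (mul_mem hu hc) (mul_mem hb hv), by
    linear_combination c * h + b * h'⟩

theorem mul_left (hc : c ∈ pIntegers p) (h : PCong p k a b) : PCong p k (c * a) (c * b) := by
  obtain ⟨u, hu, h⟩ := h
  exact ⟨c * u, mul_mem hc hu, by linear_combination c * h⟩

theorem pow (h : PCong p k a b) (hb : b ∈ pIntegers p) (n : ℕ) : PCong p k (a ^ n) (b ^ n) := by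
  induction n with
  | zero => simpa using refl 1
  | succ n ih => simpa only [pow_succ] using ih.mul h (pow_mem hb n) hb

/-- Since 0⁻¹ = 0 is p-integral, integrality of the inverses does not by itself exclude zero. -/
theorem inv (h : PCong p k a b) (ha0 : a ≠ 0) (hb0 : b ≠ 0) (ha : a⁻¹ ∈ pIntegers p)
    (hb : b⁻¹ ∈ pIntegers p) : PCong p k a⁻¹ b⁻¹ := by
  obtain ⟨u, hu, h⟩ := h
  refine ⟨-u * (a⁻¹ * b⁻¹), mul_mem (neg_mem hu) (mul_mem ha hb), ?_⟩
  field_simp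
  linear_combination -h

theorem sum {ι : Type*} {s : Finset ι} {f g : ι → ℚ} (h : ∀ i ∈ s, PCong p k (f i) (g i)) :
    PCong p k (∑ i ∈ s, f i) (∑ i ∈ s, g i) := by
  classical
  induction s using Finset.induction_on with
  | empty => simpa using refl 0
  | insert i s hi ih =>
    rw [sum_insert hi, sum_insert hi]
    exact (h i (mem_insert_self i s)).add (ih fun j hj => h j (mem_insert_of_mem hj))

theorem prod {ι : Type*} {s : Finset ι} {f g : ι → ℚ} (h : ∀ i ∈ s, PCong p k (f i) (g i))
    (hg : ∀ i ∈ s, g i ∈ pIntegers p) : PCong p k (∏ i ∈ s, f i) (∏ i ∈ s, g i) := by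
  classical
  induction s using Finset.induction_on with
  | empty => simpa using refl 1
  | insert i s hi ih =>
    rw [prod_insert hi, prod_insert hi]
    exact (h i (mem_insert_self i s)).mul (ih (fun j hj => h j (mem_insert_of_mem hj))
      fun j hj => hg j (mem_insert_of_mem hj)) (hg i (mem_insert_self i s))
      (prod_mem fun j hj => hg j (mem_insert_of_mem hj))

theorem mono {l : ℕ} (hl : l ≤ k) (h : PCong p k a b) : PCong p l a b := by
  obtain ⟨u, hu, h⟩ := h
  refine ⟨p ^ (k - l) * u, mul_mem (pow_mem (natCast_mem _ p) _) hu, ?_⟩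
  rw [h, ← mul_assoc, ← pow_add, Nat.add_sub_cancel' hl]

theorem pow_mul (l : ℕ) (h : PCong p k a b) : PCong p (l + k) (p ^ l * a) (p ^ l * b) := by
  obtain ⟨u, hu, h⟩ := h
  exact ⟨u, hu, by rw [pow_add]; linear_combination (p : ℚ) ^ l * h⟩

theorem div_prime (hp : p.Prime) (h : PCong p (k + 1) a (p * b)) : PCong p k (a / p) b := by
  obtain ⟨u, hu, h⟩ := h
  have hp0 : (p : ℚ) ≠ 0 := by exact_mod_cast hp.ne_zero
  refine ⟨u, hu, ?_⟩
  field_simp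
  rw [pow_succ] at h
  linear_combination h

theorem one_sub_div_one_sub (hp : p.Prime) (hk : k ≠ 0) (ha : a ∈ pIntegers p)
    (hb : b ∈ pIntegers p) : PCong p (k + k)
      ((1 - (p : ℚ) ^ k * a) / (1 - (p : ℚ) ^ k * b)) (1 + (p : ℚ) ^ k * (b - a)) := by
  have hi := inv_one_sub_mem hp hk hb
  have h0 : 1 - (p : ℚ) ^ k * b ≠ 0 := by
    intro h0
    have hp0 : (p : ℚ) ≠ 0 := by exact_mod_cast hp.ne_zero
    obtain ⟨l, rfl⟩ := Nat.exists_eq_succ_of_ne_zero hk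
    have : (p : ℚ)⁻¹ = p ^ l * b := by
      rw [inv_eq_of_mul_eq_one_right]
      rw [pow_succ] at h0
      linear_combination -h0
    have hm : (p : ℚ)⁻¹ ∈ pIntegers p := this ▸ mul_mem (pow_mem (natCast_mem _ p) l) hb
    rw [mem_pIntegers, Rat.inv_natCast_den_of_pos hp.pos, Nat.coprime_self] at hm
    exact hp.one_lt.ne' hm
  -- The exact remainder of the first-order expansion in p^k.
  refine ⟨b * (b - a) * (1 - (p : ℚ) ^ k * b)⁻¹, mul_mem (mul_mem hb (sub_mem hb ha)) hi, ?_⟩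
  rw [pow_add]
  field_simp
  ring

/-- First-order expansion with error p^(2k): used with k = 4 on the very-well-poised side and k = 2
on the balanced side. -/
theorem prod_one_sub_div (hp : p.Prime) (hk : k ≠ 0) {f g : ℕ → ℚ} (K : ℕ)
    (hf : ∀ t < K, f t ∈ pIntegers p) (hg : ∀ t < K, g t ∈ pIntegers p) :
    PCong p (k + k) (∏ t ∈ range K, (1 - (p : ℚ) ^ k * f t) / (1 - (p : ℚ) ^ k * g t))
      (1 + (p : ℚ) ^ k * ∑ t ∈ range K, (g t - f t)) := by
  induction K with
  | zero => simpa using refl 1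
  | succ K ih =>
    rw [prod_range_succ, sum_range_succ]
    have h1 := ih (fun t ht => hf t (by omega)) (fun t ht => hg t (by omega))
    have h2 := one_sub_div_one_sub hp hk (hf K (by omega)) (hg K (by omega))
    have m1 : ∑ t ∈ range K, (g t - f t) ∈ pIntegers p := sum_mem fun t ht =>
      sub_mem (hg t (by grind)) (hf t (by grind))
    have m2 : g K - f K ∈ pIntegers p := sub_mem (hg K (by omega)) (hf K (by omega))
    have mp : (p : ℚ) ^ k ∈ pIntegers p := pow_mem (natCast_mem _ p) k
    refine (h1.mul h2 (add_mem (one_mem _) (mul_mem mp m1))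
      (add_mem (one_mem _) (mul_mem mp m2))).trans ?_
    refine ⟨_, mul_mem m1 m2, ?_⟩
    rw [pow_add]
    ring

theorem add_pow_approx (ha : a ∈ pIntegers p) (hb : b ∈ pIntegers p) (m : ℕ) :
    PCong p (k + k) ((a + (p : ℚ) ^ k * b) ^ (m + 1))
      (a ^ m * (a + (m + 1 : ℕ) * ((p : ℚ) ^ k * b))) := by
  induction m with
  | zero => simpa using refl _
  | succ m ih =>
    have mp : (p : ℚ) ^ k ∈ pIntegers p := pow_mem (natCast_mem _ p) k
    have m1 := add_mem ha (mul_mem mp hb)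
    rw [pow_succ]
    refine (ih.mul (refl _) (mul_mem (pow_mem ha m) (add_mem ha
      (mul_mem (natCast_mem _ _) (mul_mem mp hb)))) m1).trans ?_
    refine ⟨a ^ m * ((m + 1 : ℕ) * (b * b)), mul_mem (pow_mem ha m) (mul_mem (natCast_mem _ _)
      (mul_mem hb hb)), ?_⟩
    rw [pow_add]
    push_cast
    ring

end PCong

theorem ratModEq_of_pCong {p k : ℕ} {a b : ℚ} (h : PCong p k a b) : RatModEq (p ^ k) a b := by
  obtain ⟨c, hc, h⟩ := h
  exact ⟨c, Nat.Coprime.pow_right k (mem_pIntegers.1 hc), by rw [h]; push_cast; rfl⟩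

theorem shiftedFactorial_mem {p : ℕ} {x : ℚ} (hx : x ∈ pIntegers p) (k : ℕ) :
    shiftedFactorial x k ∈ pIntegers p := by
  rw [shiftedFactorial_eq_prod]
  exact prod_mem fun j _ => add_mem hx (natCast_mem _ j)

theorem inv_shiftedFactorial_mem {p : ℕ} {x : ℚ} {k : ℕ}
    (h : ∀ j < k, (x + j)⁻¹ ∈ pIntegers p) : (shiftedFactorial x k)⁻¹ ∈ pIntegers p := by
  rw [shiftedFactorial_eq_prod, ← prod_inv_distrib]
  exact prod_mem fun j hj => h j (mem_range.1 hj)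

theorem inv_add_one_mem {p j : ℕ} (hp : p.Prime) (h : j + 1 < p) :
    ((j : ℚ) + 1)⁻¹ ∈ pIntegers p := by
  exact_mod_cast inv_natCast_mem hp (Nat.not_dvd_of_pos_of_lt (Nat.succ_pos j) h)

theorem inv_shiftedFactorial_one_mem {p k : ℕ} (hp : p.Prime) (h : k < p) :
    (shiftedFactorial 1 k)⁻¹ ∈ pIntegers p :=
  inv_shiftedFactorial_mem fun j hj => by
    rw [add_comm]; exact inv_add_one_mem hp (by omega)

/-! ### Reflection k ↦ n - k -/

/-- A sum of terms that are antisymmetric under `k ↦ n - k` vanishes. -/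
theorem sum_antisymm_eq_zero {n : ℕ} {W : ℕ → ℚ} (hW : ∀ k ≤ n, W (n - k) = W k) :
    ∑ k ∈ range (n + 1), (2 * (k : ℚ) - n) * W k = 0 := by
  have h := sum_range_reflect (fun k => (2 * (k : ℚ) - n) * W k) (n + 1)
  have h2 : ∑ j ∈ range (n + 1), (2 * ((n + 1 - 1 - j : ℕ) : ℚ) - n) * W (n + 1 - 1 - j) =
      ∑ k ∈ range (n + 1), -((2 * (k : ℚ) - n) * W k) := by
    refine sum_congr rfl fun k hk => ?_
    have hk : k ≤ n := by grind
    rw [show n + 1 - 1 - k = n - k by omega, hW k hk, Nat.cast_sub hk]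
    ring
  rw [h2, sum_neg_distrib] at h
  linarith

theorem sum_inv_pow_reflect {n k : ℕ} (hk : k ≤ n) :
    ∑ t ∈ range k, (((t : ℚ) - n) ^ 4)⁻¹ =
      ∑ t ∈ range n, (((t : ℚ) + 1) ^ 4)⁻¹ - ∑ t ∈ range (n - k), (((t : ℚ) + 1) ^ 4)⁻¹ := by
  induction k with
  | zero => simp
  | succ k ih =>
    rw [sum_range_succ, ih (by omega), show n - k = n - (k + 1) + 1 by omega, sum_range_succ]
    have : (((n - (k + 1) : ℕ) : ℚ) + 1) = n - k := by
      rw [Nat.cast_sub hk]; push_cast; ring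
    rw [this, show ((k : ℚ) - n) ^ 4 = (n - k) ^ 4 by ring]
    ring

theorem shiftedFactorial_neg_div_one {n k : ℕ} (hk : k ≤ n) :
    shiftedFactorial (-(n : ℚ)) k / shiftedFactorial 1 k = (-1) ^ k * n.choose k := by
  have h := shiftedFactorial_neg_add (n - k) k
  rw [Nat.add_sub_cancel' hk] at h
  have h1 := (shiftedFactorial_pos one_pos (n - k)).ne'
  have h2 := (shiftedFactorial_pos one_pos k).ne'
  have h3 : (n.choose k : ℚ) * shiftedFactorial 1 k * shiftedFactorial 1 (n - k) =
      shiftedFactorial 1 n := by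
    simp only [shiftedFactorial_one]
    exact_mod_cast Nat.choose_mul_factorial_mul_factorial hk
  rw [div_eq_iff h2, ← mul_left_inj' h1, h, ← h3]
  ring


/-! ### Integrality when p = r + nd -/

section

variable {p d r n : ℕ}

theorem inv_add_mem (hp : p.Prime) (hr : 0 < r) (hd : 0 < d) (hn : p = r + n * d) {j : ℕ}
    (hj : j < n) : ((r : ℚ) / d + j)⁻¹ ∈ pIntegers p := by
  have hd0 : (d : ℚ) ≠ 0 := by positivity
  have : ((r : ℚ) / d + j)⁻¹ = d * ((r + j * d : ℕ) : ℚ)⁻¹ := by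
    push_cast
    field_simp
  rw [this]
  refine mul_mem (natCast_mem _ d) (inv_natCast_mem hp (Nat.not_dvd_of_pos_of_lt (by omega) ?_))
  have := (Nat.mul_lt_mul_right hd).2 hj
  omega

/-- The number 2r + jd lies strictly between 0 and 2p, so divisibility by p would make it equal to p
= r + nd. Then d divides r, contradicting coprimality as d ≥ 2. -/
theorem inv_two_mul_add_mem (hp : p.Prime) (hr : 0 < r) (hd : 2 ≤ d) (hrd : r.gcd d = 1)
    (hn : p = r + n * d) {j : ℕ} (hj : j < n) : (2 * (r : ℚ) / d + j)⁻¹ ∈ pIntegers p := by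
  have hd0 : (d : ℚ) ≠ 0 := by positivity
  have : (2 * (r : ℚ) / d + j)⁻¹ = d * ((2 * r + j * d : ℕ) : ℚ)⁻¹ := by
    push_cast
    field_simp
  rw [this]
  refine mul_mem (natCast_mem _ d) (inv_natCast_mem hp ?_)
  rintro ⟨q, hq⟩
  obtain ⟨e, rfl⟩ := Nat.exists_eq_add_of_lt hj
  have hq1 : q = 1 := by
    have h1 : q < 2 := by
      by_contra h
      have : p * 2 ≤ p * q := Nat.mul_le_mul_left p (by omega)
      nlinarith
    have h2 : q ≠ 0 := by rintro rfl; omega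
    omega
  subst hq1
  have hdr : d ∣ r := ⟨e + 1, by nlinarith⟩
  rw [Nat.gcd_eq_right hdr] at hrd
  omega

theorem div_mem_pIntegers (hp : p.Prime) (hpd : ¬ p ∣ d) {q : ℚ} (hq : q ∈ pIntegers p) :
    q / d ∈ pIntegers p := by
  rw [div_eq_mul_inv]
  exact mul_mem hq (inv_natCast_mem hp hpd)

/-! ### From the multiple sum to a power of a single sum -/

/-- The terms `(2dk + r) (r/d)_k^6 / (1)_k^6`. -/
noncomputable def sixthTerm (d r k : ℕ) : ℚ :=
  (2 * (d : ℚ) * (k : ℚ) + r) *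
    (shiftedFactorial ((r : ℚ) / d) k ^ 6 / shiftedFactorial 1 k ^ 6)

theorem sixthTerm_mem (hp : p.Prime) (hpd : ¬ p ∣ d) {k : ℕ} (hk : k < p) :
    sixthTerm d r k ∈ pIntegers p := by
  rw [sixthTerm, div_eq_mul_inv, ← inv_pow]
  refine mul_mem (by exact_mod_cast natCast_mem (pIntegers p) (2 * d * k + r)) (mul_mem (pow_mem ?_ 6)
    (pow_mem (inv_shiftedFactorial_one_mem hp hk) 6))
  exact shiftedFactorial_mem (div_mem_pIntegers hp hpd (natCast_mem _ r)) k

theorem sixthTerm_pCong_zero (hp : p.Prime) (hd : 0 < d) (hpd : ¬ p ∣ d) (hn : p = r + n * d)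
    {k : ℕ} (hnk : n < k) (hk : k < p) : PCong p 6 (sixthTerm d r k) 0 := by
  have hd0 : (d : ℚ) ≠ 0 := by positivity
  have ha := div_mem_pIntegers hp hpd (natCast_mem (pIntegers p) r)
  obtain ⟨e, rfl⟩ := Nat.exists_eq_add_of_lt hnk
  obtain ⟨c, hc, h⟩ : ∃ c ∈ pIntegers p,
      shiftedFactorial ((r : ℚ) / d) (n + e + 1) = p * c := by
    refine ⟨shiftedFactorial ((r : ℚ) / d) n * (d : ℚ)⁻¹ *
      shiftedFactorial ((r : ℚ) / d + (n + 1 : ℕ)) e, ?_, ?_⟩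
    · exact mul_mem (mul_mem (shiftedFactorial_mem ha n) (inv_natCast_mem hp hpd))
        (shiftedFactorial_mem (add_mem ha (natCast_mem _ _)) e)
    · rw [show n + e + 1 = n + 1 + e by omega, shiftedFactorial_add, shiftedFactorial_succ]
      rw [show (p : ℚ) = r + n * d by exact_mod_cast hn]
      field_simp
  refine ⟨(2 * (d : ℚ) * ((n + e + 1 : ℕ) : ℚ) + r) *
    (c ^ 6 * (shiftedFactorial 1 (n + e + 1))⁻¹ ^ 6), mul_mem ?_ (mul_mem (pow_mem hc 6)
      (pow_mem (inv_shiftedFactorial_one_mem hp hk) 6)), ?_⟩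
  · exact_mod_cast natCast_mem (pIntegers p) (2 * d * (n + e + 1) + r)
  · rw [sixthTerm, h]
    ring

theorem sum_boundedTuples_pCong (hp : p.Prime) (hr : 0 < r) (hpd : ¬ p ∣ d)
    (hn : p = r + n * d) {m : ℕ} (hm : 0 < m) (hmd : m ≤ d) :
    PCong p 6 (∑ i ∈ boundedTuples m (p - 1), ∏ l, sixthTerm d r (i l))
      ((∑ k ∈ range (n + 1), sixthTerm d r k) ^ m) := by
  have hsub : (Fintype.piFinset fun _ : Fin m => range (n + 1)) ⊆ boundedTuples m (p - 1) := by
    intro i hi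
    rw [mem_boundedTuples]
    rw [Fintype.mem_piFinset] at hi
    have h1 : ∑ l, i l ≤ ∑ _l : Fin m, n := sum_le_sum fun l _ => by
      have := hi l
      grind
    rw [sum_const, card_univ, Fintype.card_fin, smul_eq_mul] at h1
    have h2 : m * n ≤ n * d := by rw [mul_comm]; exact Nat.mul_le_mul_left n hmd
    omega
  have hpow : (∑ k ∈ range (n + 1), sixthTerm d r k) ^ m =
      ∑ i ∈ Fintype.piFinset fun _ : Fin m => range (n + 1), ∏ l, sixthTerm d r (i l) := by
    rw [sum_prod_piFinset]
    simp
  rw [← sum_sdiff hsub, hpow]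
  have h0 : PCong p 6 (∑ i ∈ boundedTuples m (p - 1) \
      (Fintype.piFinset fun _ : Fin m => range (n + 1)), ∏ l, sixthTerm d r (i l))
      (∑ i ∈ boundedTuples m (p - 1) \
      (Fintype.piFinset fun _ : Fin m => range (n + 1)), 0) := by
    refine PCong.sum fun i hi => ?_
    rw [mem_sdiff, mem_boundedTuples, Fintype.mem_piFinset, not_forall] at hi
    obtain ⟨hi, l, hl⟩ := hi
    have hlt : ∀ l, i l < p := fun l => by
      have h1 := single_le_sum (fun j _ => Nat.zero_le (i j)) (mem_univ l)
      have h2 := hp.pos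
      omega
    rw [mem_range] at hl
    -- One coordinate exceeds n and contributes p^6; the other factors are p-integral because every
    -- coordinate is below p.
    rw [← mul_prod_erase univ _ (mem_univ l),
      ← zero_mul (∏ j ∈ univ.erase l, sixthTerm d r (i j))]
    exact (sixthTerm_pCong_zero hp (by omega) hpd hn (by omega) (hlt l)).mul (PCong.refl _)
      (zero_mem _) (prod_mem fun j _ => sixthTerm_mem hp hpd (hlt j))
  rw [sum_const_zero] at h0
  simpa using h0.add (PCong.refl (∑ i ∈ Fintype.piFinset fun _ : Fin m => range (n + 1),
    ∏ l, sixthTerm d r (i l)))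

/-! ### Vanishing of the p^4 correction -/

/-- The first-order coefficient at `t` of the ratio of the parameters `r/d` and `1` shifted
by `p ^ s / d ^ s`. -/
noncomputable def shiftCoeff (d r s t : ℕ) : ℚ :=
  (((d : ℚ) * (t + 1)) ^ s)⁻¹ - (((d : ℚ) * ((r : ℚ) / d + t)) ^ s)⁻¹

theorem inv_mul_add_one_mem (hp : p.Prime) (hpd : ¬ p ∣ d) {t : ℕ} (ht : t + 1 < p) :
    ((d : ℚ) * (t + 1))⁻¹ ∈ pIntegers p := by
  rw [mul_inv]
  exact mul_mem (inv_natCast_mem hp hpd) (inv_add_one_mem hp ht)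

theorem inv_mul_div_add_mem (hp : p.Prime) (hr : 0 < r) (hd : 0 < d) (hpd : ¬ p ∣ d)
    (hn : p = r + n * d) {t : ℕ} (ht : t < n) :
    ((d : ℚ) * ((r : ℚ) / d + t))⁻¹ ∈ pIntegers p := by
  rw [mul_inv]
  exact mul_mem (inv_natCast_mem hp hpd) (inv_add_mem hp hr hd hn ht)

theorem lt_of_eq_add_mul (hr : 0 < r) (hd : 0 < d) (hn : p = r + n * d) : n < p := by
  have := Nat.le_mul_of_pos_right n hd
  omega

/-- Modulo p, r/d ≡ -n, so the k-th sixth-power term becomes d(2k - n) times the sixth power of a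
binomial coefficient, while the inner sum becomes H(k) + H(n - k) - H(n) up to d^(-4). Everything
but 2k - n is symmetric under k ↦ n - k. -/
theorem antisymm_sum_pCong_zero (hp : p.Prime) (hr : 0 < r) (hd : 0 < d) (hpd : ¬ p ∣ d)
    (hn : p = r + n * d) :
    PCong p 1 (∑ k ∈ range (n + 1), sixthTerm d r k * ∑ t ∈ range k, shiftCoeff d r 4 t) 0 := by
  have hd0 : (d : ℚ) ≠ 0 := by positivity
  have hpq : (p : ℚ) = r + n * d := by exact_mod_cast hn
  have hdi := inv_natCast_mem hp hpd
  have hnp := lt_of_eq_add_mul hr hd hn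
  have ha := div_mem_pIntegers hp hpd (natCast_mem (pIntegers p) r)
  set H : ℕ → ℚ := fun k => ∑ t ∈ range k, (((t : ℚ) + 1) ^ 4)⁻¹ with hH
  set W : ℕ → ℚ := fun k => (n.choose k : ℚ) ^ 6 * (H k + H (n - k) - H n) with hW
  have hzero : ∑ k ∈ range (n + 1), (2 * (k : ℚ) - n) * W k = 0 := by
    refine sum_antisymm_eq_zero fun k hk => ?_
    simp only [hW]
    rw [Nat.choose_symm hk, Nat.sub_sub_self hk]
    ring
  have hsum : ∑ k ∈ range (n + 1), d * (2 * (k : ℚ) - n) *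
      ((shiftedFactorial (-(n : ℚ)) k / shiftedFactorial 1 k) ^ 6 *
        ((d : ℚ) ^ 4)⁻¹ * ∑ t ∈ range k, ((((t : ℚ) + 1) ^ 4)⁻¹ - (((t : ℚ) - n) ^ 4)⁻¹)) = 0 := by
    have : ∀ k ∈ range (n + 1), d * (2 * (k : ℚ) - n) *
      ((shiftedFactorial (-(n : ℚ)) k / shiftedFactorial 1 k) ^ 6 *
        ((d : ℚ) ^ 4)⁻¹ * ∑ t ∈ range k, ((((t : ℚ) + 1) ^ 4)⁻¹ - (((t : ℚ) - n) ^ 4)⁻¹)) =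
        d * ((d : ℚ) ^ 4)⁻¹ * ((2 * (k : ℚ) - n) * W k) := by
      intro k hk
      have hk : k ≤ n := by grind
      have h6 : ((-1 : ℚ) ^ k) ^ 6 = 1 := by
        rw [← pow_mul, mul_comm, pow_mul]; norm_num
      rw [shiftedFactorial_neg_div_one hk, sum_sub_distrib, sum_inv_pow_reflect hk, mul_pow, h6]
      simp only [hW, hH]
      ring
    rw [sum_congr rfl this, ← mul_sum, hzero, mul_zero]
  rw [← hsum]
  refine PCong.sum fun k hk => ?_
  have hk : k ≤ n := by grind
  -- The difference is exactly p/d.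
  have hadd : ∀ t : ℕ, PCong p 1 ((r : ℚ) / d + t) (t - n) := fun t =>
    ⟨(d : ℚ)⁻¹, hdi, by rw [hpq]; field_simp; ring⟩
  have hneg : ∀ t : ℕ, (t : ℚ) - n ∈ pIntegers p := fun t =>
    sub_mem (natCast_mem _ t) (natCast_mem _ n)
  have hnegi : ∀ t < n, ((t : ℚ) - n)⁻¹ ∈ pIntegers p := fun t ht => by
    have : ((t : ℚ) - n)⁻¹ = -((n - t : ℕ) : ℚ)⁻¹ := by
      rw [Nat.cast_sub ht.le, ← inv_neg, neg_sub]
    rw [this]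
    exact neg_mem (inv_natCast_mem hp (Nat.not_dvd_of_pos_of_lt (by omega) (by omega)))
  have h1 : PCong p 1 (2 * (d : ℚ) * k + r) (d * (2 * (k : ℚ) - n)) :=
    ⟨1, one_mem _, by rw [hpq]; ring⟩
  have h2 : PCong p 1 (shiftedFactorial ((r : ℚ) / d) k) (shiftedFactorial (-(n : ℚ)) k) := by
    simp only [shiftedFactorial_eq_prod]
    refine PCong.prod (fun t _ => ?_) fun t _ => ?_
    · simpa only [sub_eq_neg_add] using hadd t
    · simpa only [sub_eq_neg_add] using hneg t
  have h3 : PCong p 1 (shiftedFactorial ((r : ℚ) / d) k ^ 6 / shiftedFactorial 1 k ^ 6)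
      ((shiftedFactorial (-(n : ℚ)) k / shiftedFactorial 1 k) ^ 6) := by
    rw [← div_pow, div_eq_mul_inv, div_eq_mul_inv]
    have mi := inv_shiftedFactorial_one_mem hp (hk.trans_lt hnp)
    have ms := shiftedFactorial_mem (neg_mem (natCast_mem (pIntegers p) n)) k
    exact (h2.mul (PCong.refl _) ms mi).pow (mul_mem ms mi) 6
  have h4 : PCong p 1 (∑ t ∈ range k, shiftCoeff d r 4 t)
      (((d : ℚ) ^ 4)⁻¹ * ∑ t ∈ range k, ((((t : ℚ) + 1) ^ 4)⁻¹ - (((t : ℚ) - n) ^ 4)⁻¹)) := by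
    rw [mul_sum]
    refine PCong.sum fun t ht => ?_
    have ht : t < n := by grind
    rw [shiftCoeff, mul_pow, mul_pow, mul_inv, mul_inv, ← mul_sub]
    refine PCong.mul_left (by rw [← inv_pow]; exact pow_mem hdi 4) ((PCong.refl _).sub ?_)
    rw [← inv_pow, ← inv_pow]
    refine ((hadd t).inv (by positivity) ?_ (inv_add_mem hp hr hd hn ht) (hnegi t ht)).pow
      (hnegi t ht) 4
    have : (t : ℚ) < n := by exact_mod_cast ht
    exact (sub_neg.2 this).ne
  have mi : shiftedFactorial (-(n : ℚ)) k / shiftedFactorial 1 k ∈ pIntegers p := by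
    rw [div_eq_mul_inv]
    exact mul_mem (shiftedFactorial_mem (neg_mem (natCast_mem _ n)) k)
      (inv_shiftedFactorial_one_mem hp (hk.trans_lt hnp))
  have md : (d : ℚ) * (2 * (k : ℚ) - n) ∈ pIntegers p := h1.symm.mem (by
    exact_mod_cast natCast_mem (pIntegers p) (2 * d * k + r))
  have mS : ((d : ℚ) ^ 4)⁻¹ * ∑ t ∈ range k, ((((t : ℚ) + 1) ^ 4)⁻¹ - (((t : ℚ) - n) ^ 4)⁻¹) ∈
      pIntegers p := by
    rw [← inv_pow]
    refine mul_mem (pow_mem hdi 4) (sum_mem fun t ht => ?_)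
    have ht : t < n := by grind
    rw [← inv_pow, ← inv_pow]
    exact sub_mem (pow_mem (inv_add_one_mem hp (by omega)) 4) (pow_mem (hnegi t ht) 4)
  rw [sixthTerm, mul_assoc (2 * (d : ℚ) * k + r), mul_assoc (_ ^ 6)]
  exact h1.mul (h3.mul h4 (pow_mem mi 6) mS) md (mul_mem (pow_mem mi 6) mS)

/-! ### Whipple's transformation at x = p/d, y = -x² -/

theorem shiftedFactorial_sq_mul_prod {z X : ℚ} {k : ℕ} (hz : ∀ t < k, z + t ≠ 0) :
    shiftedFactorial z k ^ 2 * ∏ t ∈ range k, (1 - X * ((z + t) ^ 2)⁻¹) =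
      ∏ t ∈ range k, ((z + t) ^ 2 - X) := by
  rw [shiftedFactorial_eq_prod, ← prod_pow, ← prod_mul_distrib]
  refine prod_congr rfl fun t ht => ?_
  have := hz t (mem_range.1 ht)
  field_simp

theorem shiftedFactorial_add_mul_sub (a x : ℚ) (k : ℕ) :
    shiftedFactorial (a + x) k * shiftedFactorial (a - x) k =
      ∏ t ∈ range k, ((a + t) ^ 2 - x ^ 2) := by
  simp only [shiftedFactorial_eq_prod, ← prod_mul_distrib]
  exact prod_congr rfl fun t _ => by ring

theorem sqProd_eq (X : ℚ) (k : ℕ) :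
    sqProd X k = shiftedFactorial 1 k ^ 2 * ∏ t ∈ range k, (1 - X * (((t : ℚ) + 1) ^ 2)⁻¹) := by
  have h := shiftedFactorial_sq_mul_prod (z := 1) (X := X) (k := k) fun t _ => by positivity
  simp only [add_comm (1 : ℚ)] at h
  rw [h, sqProd]

/-- The choice y = -x² pairs 1 - x²/z² with 1 + x²/z², so only x^4 survives. -/
theorem vwpTerm_mul_eq {a x : ℚ} {k : ℕ} (ha : 0 < a) :
    vwpTerm a x k * ((∏ t ∈ range k, ((a + t) ^ 2 - -x ^ 2)) / sqProd (-x ^ 2) k) =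
      (a + 2 * k) * (shiftedFactorial a k ^ 6 / shiftedFactorial 1 k ^ 6) *
        ∏ t ∈ range k, (1 - x ^ 4 * ((a + t) ^ 4)⁻¹) / (1 - x ^ 4 * (((t : ℚ) + 1) ^ 4)⁻¹) := by
  have ha' : ∀ t < k, a + t ≠ 0 := fun t _ => by positivity
  have h1 := shiftedFactorial_add_mul_sub a x k
  have h2 := shiftedFactorial_add_mul_sub 1 x k
  rw [← shiftedFactorial_sq_mul_prod fun t _ => by positivity] at h2
  rw [← shiftedFactorial_sq_mul_prod ha'] at h1
  have h3 := sqProd_eq (-x ^ 2) k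
  have h4 : ∀ z : ℕ → ℚ, ∏ t ∈ range k, (1 - x ^ 4 * (z t ^ 4)⁻¹) =
      (∏ t ∈ range k, (1 - x ^ 2 * (z t ^ 2)⁻¹)) * ∏ t ∈ range k, (1 - -x ^ 2 * (z t ^ 2)⁻¹) := by
    intro z
    rw [← prod_mul_distrib]
    exact prod_congr rfl fun t _ => by
      rw [← inv_pow, ← inv_pow]
      ring
  simp only [add_comm (1 : ℚ)] at h2
  rw [prod_div_distrib, h4 fun t => a + t, h4 fun t => (t : ℚ) + 1, h3,
    ← shiftedFactorial_sq_mul_prod ha', vwpTerm]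
  have h2' : shiftedFactorial (1 - x) k * shiftedFactorial (1 + x) k =
      shiftedFactorial 1 k ^ 2 * ∏ t ∈ range k, (1 - x ^ 2 * (((t : ℚ) + 1) ^ 2)⁻¹) := by
    rw [← h2, mul_comm, add_comm 1 x]
  rw [mul_assoc (_ ^ 2) (shiftedFactorial (a + x) k), h1,
    mul_assoc (_ ^ 2) (shiftedFactorial (1 - x) k), h2']
  generalize shiftedFactorial a k = g1
  generalize shiftedFactorial 1 k = g2
  simp only [div_eq_mul_inv, mul_inv]
  ring

/-- On the balanced side a ± x is above and 1 ± ix below, so no such pairing occurs and the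
deviation is of order x². -/
theorem hyp_mul_eq {a x : ℚ} {k : ℕ} (ha : 0 < a) :
    shiftedFactorial a k * shiftedFactorial (1 - a) k *
          shiftedFactorial (a + x) k * shiftedFactorial (a - x) k /
            (shiftedFactorial 1 k * shiftedFactorial (2 * a) k * sqProd (-x ^ 2) k) =
      shiftedFactorial a k ^ 3 * shiftedFactorial (1 - a) k /
          (shiftedFactorial 1 k ^ 3 * shiftedFactorial (2 * a) k) *
        ∏ t ∈ range k, (1 - x ^ 2 * ((a + t) ^ 2)⁻¹) / (1 - x ^ 2 * -(((t : ℚ) + 1) ^ 2)⁻¹) := by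
  have ha' : ∀ t < k, a + t ≠ 0 := fun t _ => by positivity
  have h1 := shiftedFactorial_add_mul_sub a x k
  rw [← shiftedFactorial_sq_mul_prod ha'] at h1
  rw [prod_div_distrib, mul_assoc (_ * _) (shiftedFactorial (a + x) k), h1, sqProd_eq]
  simp only [neg_mul, mul_neg, div_eq_mul_inv, mul_inv]
  ring

theorem pow_mul_inv_scaled (s : ℕ) (z : ℚ) :
    ((p : ℚ) / d) ^ s * (z ^ s)⁻¹ = (p : ℚ) ^ s * ((d * z) ^ s)⁻¹ := by
  rw [div_pow, mul_pow, mul_inv]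
  ring

theorem sum_vwp_pCong (hp : p.Prime) (hr : 0 < r) (hd : 0 < d) (hpd : ¬ p ∣ d)
    (hn : p = r + n * d) :
    PCong p 5 (d * ∑ k ∈ range (n + 1), vwpTerm ((r : ℚ) / d) ((p : ℚ) / d) k *
        ((∏ t ∈ range k, (((r : ℚ) / d + t) ^ 2 - -((p : ℚ) / d) ^ 2)) /
          sqProd (-((p : ℚ) / d) ^ 2) k))
      (∑ k ∈ range (n + 1), sixthTerm d r k) := by
  have hd0 : (d : ℚ) ≠ 0 := by positivity
  have hnp := lt_of_eq_add_mul hr hd hn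
  have hT := (antisymm_sum_pCong_zero hp hr hd hpd hn).pow_mul 4
  have h8 : PCong p 5 (d * ∑ k ∈ range (n + 1), vwpTerm ((r : ℚ) / d) ((p : ℚ) / d) k *
        ((∏ t ∈ range k, (((r : ℚ) / d + t) ^ 2 - -((p : ℚ) / d) ^ 2)) /
          sqProd (-((p : ℚ) / d) ^ 2) k))
      (∑ k ∈ range (n + 1), sixthTerm d r k * (1 + (p : ℚ) ^ 4 *
        ∑ t ∈ range k, shiftCoeff d r 4 t)) := by
    rw [mul_sum]
    refine PCong.sum fun k hk => ?_
    have hk : k ≤ n := by grind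
    rw [vwpTerm_mul_eq (by positivity)]
    have e : (d : ℚ) * (((r : ℚ) / d + 2 * k) * (shiftedFactorial ((r : ℚ) / d) k ^ 6 /
        shiftedFactorial 1 k ^ 6) * ∏ t ∈ range k, (1 - ((p : ℚ) / d) ^ 4 *
          (((r : ℚ) / d + t) ^ 4)⁻¹) / (1 - ((p : ℚ) / d) ^ 4 * (((t : ℚ) + 1) ^ 4)⁻¹)) =
        sixthTerm d r k * ∏ t ∈ range k, (1 - (p : ℚ) ^ 4 *
          ((d * ((r : ℚ) / d + t)) ^ 4)⁻¹) / (1 - (p : ℚ) ^ 4 * ((d * ((t : ℚ) + 1)) ^ 4)⁻¹) := by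
      simp only [pow_mul_inv_scaled, sixthTerm, ← mul_assoc]
      congr 2
      field_simp
      ring
    rw [e]
    refine PCong.mul_left (sixthTerm_mem hp hpd (hk.trans_lt hnp)) ?_
    refine (PCong.prod_one_sub_div hp (by norm_num) k (fun t ht => ?_) fun t ht => ?_).mono
      (by norm_num)
    · rw [← inv_pow]
      exact pow_mem (inv_mul_div_add_mem hp hr hd hpd hn (by omega)) 4
    · rw [← inv_pow]
      exact pow_mem (inv_mul_add_one_mem hp hpd (by omega)) 4
  refine h8.trans ?_
  have := (PCong.refl (∑ k ∈ range (n + 1), sixthTerm d r k)).add hT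
  rw [mul_zero, add_zero] at this
  convert this using 1
  rw [mul_sum, ← sum_add_distrib]
  exact sum_congr rfl fun k _ => by ring

/-! ### Expansion of the balanced series and the sum S -/

theorem inv_shiftedFactorial_two_mul_mem (hp : p.Prime) (hr : 0 < r) (hd : 2 ≤ d)
    (hrd : r.gcd d = 1) (hn : p = r + n * d) {k : ℕ} (hk : k ≤ n) :
    (shiftedFactorial (2 * (r : ℚ) / d) k)⁻¹ ∈ pIntegers p :=
  inv_shiftedFactorial_mem fun _ hj => inv_two_mul_add_mem hp hr hd hrd hn (by omega)

theorem hypTerm_mem (hp : p.Prime) (hr : 0 < r) (hd : 2 ≤ d) (hpd : ¬ p ∣ d)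
    (hrd : r.gcd d = 1) (hn : p = r + n * d) {k : ℕ} (hk : k ≤ n) :
    hypTerm d r k ∈ pIntegers p := by
  have hnp := lt_of_eq_add_mul hr (by omega) hn
  rw [hypTerm, div_eq_mul_inv, mul_inv, ← inv_pow]
  refine mul_mem (mul_mem (pow_mem (shiftedFactorial_mem ?_ k) 3) (shiftedFactorial_mem ?_ k))
    (mul_mem (pow_mem (inv_shiftedFactorial_one_mem hp (by omega)) 3)
      (inv_shiftedFactorial_two_mul_mem hp hr hd hrd hn hk))
  · exact div_mem_pIntegers hp hpd (natCast_mem _ r)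
  · exact div_mem_pIntegers hp hpd (sub_mem (natCast_mem _ d) (natCast_mem _ r))

/-- The coefficient of `p ^ 2` in the expansion of the `k`-th term of the `₄F₃` series. -/
noncomputable def secondCoeff (d r k : ℕ) : ℚ :=
  ∑ t ∈ range k, (-(((d : ℚ) * (t + 1)) ^ 2)⁻¹ - (((d : ℚ) * ((r : ℚ) / d + t)) ^ 2)⁻¹)

theorem secondCoeff_eq (hd : 0 < d) (k : ℕ) :
    secondCoeff d r k =
      -∑ t ∈ Icc 1 k, (1 / ((d : ℚ) * t - d + r) ^ 2 + 1 / ((d : ℚ) * t) ^ 2) := by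
  have hd0 : (d : ℚ) ≠ 0 := by positivity
  rw [secondCoeff, ← Ico_add_one_right_eq_Icc, sum_Ico_eq_sum_range, ← sum_neg_distrib]
  refine sum_congr (by simp) fun t _ => ?_
  have e : (d : ℚ) * ((r : ℚ) / d + t) = d * ((1 + t : ℕ) : ℚ) - d + r := by
    push_cast
    field_simp
    ring
  rw [e]
  push_cast
  ring

theorem secondCoeff_mem (hp : p.Prime) (hr : 0 < r) (hd : 0 < d) (hpd : ¬ p ∣ d)
    (hn : p = r + n * d) {k : ℕ} (hk : k ≤ n) : secondCoeff d r k ∈ pIntegers p := by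
  have hnp := lt_of_eq_add_mul hr hd hn
  refine sum_mem fun t ht => ?_
  have ht : t < n := by grind
  rw [← inv_pow, ← inv_pow]
  exact sub_mem (neg_mem (pow_mem (inv_mul_add_one_mem hp hpd (by omega)) 2))
    (pow_mem (inv_mul_div_add_mem hp hr hd hpd hn ht) 2)

theorem hyp_mul_pCong (hp : p.Prime) (hr : 0 < r) (hd : 2 ≤ d) (hpd : ¬ p ∣ d)
    (hrd : r.gcd d = 1) (hn : p = r + n * d) {k : ℕ} (hk : k ≤ n) :
    PCong p 4 (shiftedFactorial ((r : ℚ) / d) k * shiftedFactorial (1 - (r : ℚ) / d) k *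
          shiftedFactorial ((r : ℚ) / d + (p : ℚ) / d) k *
          shiftedFactorial ((r : ℚ) / d - (p : ℚ) / d) k /
            (shiftedFactorial 1 k * shiftedFactorial (2 * ((r : ℚ) / d)) k *
              sqProd (-((p : ℚ) / d) ^ 2) k))
      (hypTerm d r k * (1 + (p : ℚ) ^ 2 * secondCoeff d r k)) := by
  have hd0 : (d : ℚ) ≠ 0 := by positivity
  have hnp := lt_of_eq_add_mul hr (by omega) hn
  rw [hyp_mul_eq (by positivity)]
  have e1 : (1 : ℚ) - (r : ℚ) / d = ((d : ℚ) - r) / d := by field_simp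
  rw [e1, ← mul_div_assoc]
  refine PCong.mul_left (hypTerm_mem hp hr hd hpd hrd hn hk) ?_
  simp only [mul_neg, pow_mul_inv_scaled]
  simp only [← mul_neg ((p : ℚ) ^ 2)]
  refine PCong.prod_one_sub_div (k := 2) hp (by norm_num) k (fun t ht => ?_) fun t ht => ?_
  · rw [← inv_pow]
    exact pow_mem (inv_mul_div_add_mem hp hr (by omega) hpd hn (by omega)) 2
  · rw [← inv_pow]
    exact neg_mem (pow_mem (inv_mul_add_one_mem hp hpd (by omega)) 2)

theorem sum_sixthTerm_pCong (hp : p.Prime) (hr : 0 < r) (hd : 2 ≤ d) (hpd : ¬ p ∣ d)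
    (hrd : r.gcd d = 1) (hn : p = r + n * d) :
    PCong p 5 (∑ k ∈ range (n + 1), sixthTerm d r k)
      (p * ((shiftedFactorial (2 * (r : ℚ) / d) n / shiftedFactorial 1 n) *
        (∑ k ∈ range (n + 1), hypTerm d r k +
          (p : ℚ) ^ 2 * ∑ k ∈ range (n + 1), hypTerm d r k * secondCoeff d r k))) := by
  have hd0 : (d : ℚ) ≠ 0 := by positivity
  have hnp := lt_of_eq_add_mul hr (by omega) hn
  have h := (sum_vwp_pCong hp hr (by omega) hpd hn).symm
  have hx : (p : ℚ) / d = (r : ℚ) / d + n := by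
    rw [show (p : ℚ) = r + n * d by exact_mod_cast hn]
    field_simp
  rw [whipple (by positivity) hx fun t => by
    rw [sub_neg_eq_add]; positivity] at h
  have hC : shiftedFactorial (2 * (r : ℚ) / d) n / shiftedFactorial 1 n ∈ pIntegers p := by
    rw [div_eq_mul_inv]
    refine mul_mem (shiftedFactorial_mem (div_mem_pIntegers hp hpd ?_) n)
      (inv_shiftedFactorial_one_mem hp hnp)
    exact_mod_cast natCast_mem (pIntegers p) (2 * r)
  have h2 := ((PCong.sum fun k (hk : k ∈ range (n + 1)) => hyp_mul_pCong hp hr hd hpd hrd hn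
    (Nat.lt_succ_iff.1 (mem_range.1 hk))).mul_left hC).pow_mul 1
  rw [pow_one] at h2
  refine (h.trans ?_).trans (h2.trans ?_)
  -- The prefactor d of the sum meets the x = p/d of the transformation, leaving the single factor
  -- p.
  · convert PCong.refl _ using 1
    rw [mul_div_assoc 2 (r : ℚ) (d : ℚ)]
    field_simp
  · convert PCong.refl _ using 1
    rw [mul_sum _ _ ((p : ℚ) ^ 2), ← sum_add_distrib]
    congr 2
    exact sum_congr rfl fun k _ => by ring

end

/-! ### Assembly -/

theorem mainTheorem7 (p d m r : ℕ) (hp : p.Prime) (hp_odd : Odd p)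
    (hr : 0 < r) (hrp : r ≤ p) (hpr : p ≡ r [MOD d]) (hrd : Nat.gcd r d = 1)
    (hm : 2 ≤ m) (hmd : m ≤ d) :
    RatModEq (p ^ 6)
      (∑ i ∈ boundedTuples m (p - 1),
        ∏ l, ((2 * (d : ℚ) * (i l : ℚ) + r) *
          (shiftedFactorial ((r : ℚ) / d) (i l) ^ 6 / shiftedFactorial 1 (i l) ^ 6)))
      ((p : ℚ) ^ m *
        (shiftedFactorial (2 * (r : ℚ) / d) ((p - r) / d) ^ m /
          shiftedFactorial 1 ((p - r) / d) ^ m) *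
        (∑ k ∈ Finset.range ((p - r) / d + 1), hypTerm d r k) ^ (m - 1) *
        ∑ k ∈ Finset.range ((p - r) / d + 1),
          hypTerm d r k *
            (1 - (m : ℚ) * (p : ℚ) ^ 2 *
              ∑ t ∈ Finset.Icc 1 k,
                (1 / ((d : ℚ) * t - d + r) ^ 2 + 1 / ((d : ℚ) * t) ^ 2))) := by
  have hd : 2 ≤ d := hm.trans hmd
  have hn : p = r + (p - r) / d * d := by
    rw [Nat.div_mul_cancel ((Nat.modEq_iff_dvd' hrp).1 hpr.symm)]
    omega
  generalize (p - r) / d = n at hn ⊢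
  have hpd : ¬ p ∣ d := by
    intro h
    have h1 : p ∣ r := (Nat.dvd_add_left (h.mul_left n)).1 (hn ▸ dvd_refl p)
    exact hp.one_lt.ne' (Nat.dvd_one.1 (hrd ▸ Nat.dvd_gcd h1 h))
  have hnp := lt_of_eq_add_mul hr (by omega) hn
  refine ratModEq_of_pCong ((sum_boundedTuples_pCong hp hr hpd hn (by omega) hmd).trans ?_)
  have hC : shiftedFactorial (2 * (r : ℚ) / d) n / shiftedFactorial 1 n ∈ pIntegers p := by
    rw [div_eq_mul_inv]
    refine mul_mem (shiftedFactorial_mem (div_mem_pIntegers hp hpd ?_) n)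
      (inv_shiftedFactorial_one_mem hp hnp)
    exact_mod_cast natCast_mem (pIntegers p) (2 * r)
  have hF : ∑ k ∈ range (n + 1), hypTerm d r k ∈ pIntegers p := sum_mem fun k hk =>
    hypTerm_mem hp hr hd hpd hrd hn (by grind)
  have hH : ∑ k ∈ range (n + 1), hypTerm d r k * secondCoeff d r k ∈ pIntegers p :=
    sum_mem fun k hk => mul_mem (hypTerm_mem hp hr hd hpd hrd hn (by grind))
      (secondCoeff_mem hp hr (by omega) hpd hn (by grind))
  have hS := (sum_sixthTerm_pCong hp hr hd hpd hrd hn).div_prime hp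
  have hFH := add_mem hF (mul_mem (pow_mem (natCast_mem (pIntegers p) p) 2) hH)
  have hpow := hS.pow (mul_mem hC hFH) m
  obtain ⟨l, rfl⟩ := Nat.exists_eq_add_of_le' (by omega : 1 ≤ m)
  have happ := (PCong.add_pow_approx (k := 2) hF hH l).mul_left (pow_mem hC (l + 1))
  rw [mul_pow] at hpow
  -- With m = l + 1 the precision is p^(m+4); this is where m ≥ 2 enters.
  have hfin := ((hpow.trans happ).pow_mul (l + 1)).mono (by omega : 6 ≤ l + 1 + 4)
  have hp0 : (p : ℚ) ≠ 0 := by exact_mod_cast hp.ne_zero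
  rw [← mul_pow, mul_div_cancel₀ _ hp0] at hfin
  convert hfin using 1
  have hlast : ∑ k ∈ range (n + 1), hypTerm d r k * (1 - ((l + 1 : ℕ) : ℚ) * (p : ℚ) ^ 2 *
      ∑ t ∈ Icc 1 k, (1 / ((d : ℚ) * t - d + r) ^ 2 + 1 / ((d : ℚ) * t) ^ 2)) =
      ∑ k ∈ range (n + 1), hypTerm d r k + ((l + 1 : ℕ) : ℚ) *
        ((p : ℚ) ^ 2 * ∑ k ∈ range (n + 1), hypTerm d r k * secondCoeff d r k) := by
    simp only [mul_sum (range (n + 1)), ← sum_add_distrib]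
    refine sum_congr rfl fun k _ => ?_
    rw [secondCoeff_eq (by omega)]
    ring
  rw [hlast, ← div_pow, Nat.add_sub_cancel]
  ring
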